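/- Let $n\ge 2$ and let $(M,g)$ be an $(n+1)$-dimensional spacetime, i.e. a smooth manifold with a smooth metric $g$ of Lorentzian signature $(-,+,\dots,+)$ and Levi-Civita connection $\nabla$. Suppose that $M$ admits a \emph{spacetime convex function}: a smooth function $f:M\to\mathbb R$ whose Hessian $\nabla_\mu\nabla_\nu f$ has Lorentzian signature everywhere and for which there is a constant $c>0$ with $$V^\mu V^\nu\nabla_\mu\nabla_\nu f\ \ge\ c\,g_{\mu\nu}V^\mu V^\nu\qquad\text{for all } V\in TM .$$ Let $S\subset M$ be a closed spacelike surface, i.e. a non-empty compact embedded submanifold without boundary, of codimension two (dimension $n-1$), whose induced metric is positive definite. Suppose that near $S$ the metric splits in the following sense: every point of $S$ has a neighbourhood with smooth coordinates $(y^a,z^p)$, $a=0,1$, $p=2,\dots,n$, in which $S$ is a slice $y=\mathrm{const}$ and $$g_{\mu\nu}dx^\mu dx^\nu=\gamma_{ab}\,dy^a dy^b+k_{pq}\,dz^p dz^q ,$$ where $\gamma_{ab}$ is a two-dimensional Lorentzian metric whose components do not depend on the $z^p$, while $k_{pq}$ may depend on all coordinates and restricts on $S$ to the induced metric. Then $S$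 is not marginally inner and outer trapped. Here $S$ is called \emph{marginally inner and outer trapped} if near every point of $S$ there are smooth vector fields $l,m$ which along $S$ are null and normal to $S$, with $g(l,m)=-1$, and whose expansions $\theta_l=k^{pq}\nabla_p l_q$ and $\theta_m=k^{pq}\nabla_p m_q$ (the trace over $TS$ with respect to the induced metric) both vanish on $S$. -/

import Mathlib

open scoped Manifold ContDiff

noncomputable section

/-- The model space `ℝⁿ⁺¹` of an `(n+1)`-dimensional spacetime. -/
abbrev Coord (n : ℕ) : Type := EuclideanSpace ℝ (Fin (n + 1))

/-- Indices `a = 0, 1` of the coordinates `y^a` transverse to a codimension-two surface. -/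
abbrev YIdx (n : ℕ) : Type := {i : Fin (n + 1) // i.val < 2}

/-- The remaining indices `p = 2, …, n` of the coordinates `z^p` along the surface. -/
abbrev ZIdx (n : ℕ) : Type := {i : Fin (n + 1) // 2 ≤ i.val}

/-- A coordinate system of the smooth manifold `M`: a chart of its maximal smooth atlas. -/
def IsCoordSystem (n : ℕ) (M : Type*) [TopologicalSpace M] [ChartedSpace (Coord n) M]
    (e : OpenPartialHomeomorph M (Coord n)) : Prop :=
  e ∈ IsManifold.maximalAtlas 𝓘(ℝ, Coord n) ∞ M

/-- A (symmetric) real matrix has Lorentzian signature `(-, +, …, +)`: the form that it represents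
has an orthonormal basis (the columns of `P`) with exactly one timelike vector. -/
def HasLorentzSignature {ι : Type*} [Fintype ι] [DecidableEq ι] (A : Matrix ι ι ℝ) : Prop :=
  ∃ (t : ι) (P : Matrix ι ι ℝ), IsUnit P.det ∧
    P.transpose * A * P = Matrix.diagonal (fun i => if i = t then (-1 : ℝ) else 1)

/-- The value `A_{ij} V^i V^j` of a quadratic form. -/
def quadForm {ι : Type*} [Fintype ι] (A : Matrix ι ι ℝ) (V : ι → ℝ) : ℝ :=
  ∑ i, ∑ j, A i j * V i * V j

/-- The partial derivative `∂_i φ`. -/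
def partialD {n : ℕ} (i : Fin (n + 1)) (φ : Coord n → ℝ) (u : Coord n) : ℝ :=
  fderiv ℝ φ u (EuclideanSpace.single i 1)

/-- The coordinate vector `∂_i` of the coordinate system `e`, at the point with coordinates `u`. -/
def coordVec {n : ℕ} {M : Type*} [TopologicalSpace M] [ChartedSpace (Coord n) M]
    (e : OpenPartialHomeomorph M (Coord n)) (u : Coord n) (i : Fin (n + 1)) :
    TangentSpace 𝓘(ℝ, Coord n) (e.symm u) :=
  mfderiv 𝓘(ℝ, Coord n) 𝓘(ℝ, Coord n) e.symm u (EuclideanSpace.single i (1 : ℝ) : Coord n)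

/-- The components `g_{ij} = g(∂_i, ∂_j)` of a covariant two-tensor field in the coordinate
system `e`, as functions of the coordinates. -/
def tensorComp {n : ℕ} {M : Type*} [TopologicalSpace M] [ChartedSpace (Coord n) M]
    (g : ∀ x : M, LinearMap.BilinForm ℝ (TangentSpace 𝓘(ℝ, Coord n) x))
    (e : OpenPartialHomeomorph M (Coord n)) (u : Coord n) :
    Matrix (Fin (n + 1)) (Fin (n + 1)) ℝ :=
  Matrix.of fun i j => g (e.symm u) (coordVec e u i) (coordVec e u j)

/-- A smooth Lorentzian metric on the `(n+1)`-dimensional manifold `M`. -/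
structure LorentzMetric (n : ℕ) (M : Type*) [TopologicalSpace M] [ChartedSpace (Coord n) M] where
  /-- the bilinear form on each tangent space -/
  form : ∀ x : M, LinearMap.BilinForm ℝ (TangentSpace 𝓘(ℝ, Coord n) x)
  symm : ∀ (x : M) (v w : TangentSpace 𝓘(ℝ, Coord n) x), form x v w = form x w v
  smooth : ∀ e : OpenPartialHomeomorph M (Coord n), IsCoordSystem n M e → ∀ i j,
    ContDiffOn ℝ ∞ (fun u => tensorComp form e u i j) e.target
  lorentz : ∀ e : OpenPartialHomeomorph M (Coord n), IsCoordSystem n M e → ∀ u ∈ e.target,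
    HasLorentzSignature (tensorComp form e u)

namespace LorentzMetric

variable {n : ℕ} {M : Type*} [TopologicalSpace M] [ChartedSpace (Coord n) M]

/-- The components `g_{ij}` of the metric in the coordinate system `e`. -/
def comp (g : LorentzMetric n M) (e : OpenPartialHomeomorph M (Coord n)) (u : Coord n) :
    Matrix (Fin (n + 1)) (Fin (n + 1)) ℝ :=
  tensorComp g.form e u

/-- The Christoffel symbols `Γ^k_{ij} = ½ g^{kl} (∂_i g_{jl} + ∂_j g_{il} - ∂_l g_{ij})` of the
Levi-Civita connection. -/
def christoffel (g : LorentzMetric n M) (e : OpenPartialHomeomorph M (Coord n)) (u : Coord n)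
    (k i j : Fin (n + 1)) : ℝ :=
  (1 / 2 : ℝ) * ∑ l, (g.comp e u)⁻¹ k l *
    (partialD i (fun v => g.comp e v j l) u + partialD j (fun v => g.comp e v i l) u
      - partialD l (fun v => g.comp e v i j) u)

/-- The Hessian `∇_i ∇_j f = ∂_i ∂_j f - Γ^k_{ij} ∂_k f` in the coordinate system `e`. -/
def hess (g : LorentzMetric n M) (f : M → ℝ) (e : OpenPartialHomeomorph M (Coord n))
    (u : Coord n) : Matrix (Fin (n + 1)) (Fin (n + 1)) ℝ :=
  Matrix.of fun i j =>
    partialD i (fun v => partialD j (fun w => f (e.symm w)) v) u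
      - ∑ k, g.christoffel e u k i j * partialD k (fun w => f (e.symm w)) u

/-- `f` is a spacetime convex function: it is smooth, its Hessian has Lorentzian signature, and
`∇_μ ∇_ν f ≥ c g_{μν}` for some constant `c > 0`. -/
def IsSpacetimeConvex (g : LorentzMetric n M) (f : M → ℝ) : Prop :=
  ContMDiff 𝓘(ℝ, Coord n) 𝓘(ℝ, ℝ) ∞ f ∧
  (∀ e : OpenPartialHomeomorph M (Coord n), IsCoordSystem n M e → ∀ u ∈ e.target,
    HasLorentzSignature (g.hess f e u)) ∧
  ∃ c : ℝ, 0 < c ∧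
    ∀ e : OpenPartialHomeomorph M (Coord n), IsCoordSystem n M e → ∀ u ∈ e.target,
      ∀ V : Fin (n + 1) → ℝ, c * quadForm (g.comp e u) V ≤ quadForm (g.hess f e u) V

/-- The coordinates `(y^a, z^p)` of `e` are adapted to `S`: in the domain of `e`, the set `S` is a
slice `y = const`. -/
def _root_.IsAdaptedCoord (S : Set M) (e : OpenPartialHomeomorph M (Coord n)) : Prop :=
  IsCoordSystem n M e ∧
  ∃ y₀ : YIdx n → ℝ, ∀ u ∈ e.target, e.symm u ∈ S ↔ ∀ a : YIdx n, u a.val = y₀ a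

/-- The components `k_{pq}` of the metric along the coordinates `z^p`; in adapted coordinates and
at points of `S`, this is the induced metric of `S`. -/
def zComp (g : LorentzMetric n M) (e : OpenPartialHomeomorph M (Coord n)) (u : Coord n) :
    Matrix (ZIdx n) (ZIdx n) ℝ :=
  (g.comp e u).submatrix Subtype.val Subtype.val

/-- The components `γ_{ab}` of the metric along the coordinates `y^a`. -/
def yComp (g : LorentzMetric n M) (e : OpenPartialHomeomorph M (Coord n)) (u : Coord n) :
    Matrix (YIdx n) (YIdx n) ℝ :=
  (g.comp e u).submatrix Subtype.val Subtype.val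

/-- `S` is a closed spacelike surface: a non-empty compact (boundaryless) embedded submanifold of
codimension two, whose induced metric is positive definite. -/
structure IsClosedSpacelikeSurface (g : LorentzMetric n M) (S : Set M) : Prop where
  nonempty : S.Nonempty
  compact : IsCompact S
  embedded : ∀ x ∈ S, ∃ e : OpenPartialHomeomorph M (Coord n), IsAdaptedCoord S e ∧ x ∈ e.source
  spacelike : ∀ e : OpenPartialHomeomorph M (Coord n), IsAdaptedCoord S e →
    ∀ u ∈ e.target, e.symm u ∈ S → (g.zComp e u).PosDef

/-- In the coordinate system `e` the metric is `γ_{ab} dy^a dy^b + k_{pq} dz^p dz^q`, where `γ` is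
a Lorentzian metric in two dimensions with components independent of the `z^p`. -/
structure SplitsIn (g : LorentzMetric n M) (e : OpenPartialHomeomorph M (Coord n)) : Prop where
  block : ∀ u ∈ e.target, ∀ (a : YIdx n) (p : ZIdx n), g.comp e u a.val p.val = 0
  lorentz : ∀ u ∈ e.target, HasLorentzSignature (g.yComp e u)
  indep : ∀ u ∈ e.target, ∀ v ∈ e.target, (∀ a : YIdx n, u a.val = v a.val) →
    g.yComp e u = g.yComp e v

/-- Near `S` the metric splits as `γ_{ab}(y) dy^a dy^b + k_{pq}(y, z) dz^p dz^q`, in coordinates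
in which `S` is a slice `y = const`. -/
def SplitsNear (g : LorentzMetric n M) (S : Set M) : Prop :=
  ∀ x ∈ S, ∃ e : OpenPartialHomeomorph M (Coord n),
    IsAdaptedCoord S e ∧ x ∈ e.source ∧ g.SplitsIn e

/-- The pairing `g_{ij} V^i W^j`. -/
def pair (g : LorentzMetric n M) (e : OpenPartialHomeomorph M (Coord n)) (u : Coord n)
    (V W : Fin (n + 1) → ℝ) : ℝ :=
  ∑ i, ∑ j, g.comp e u i j * V i * W j

/-- The covariant derivative `∇_i l^k = ∂_i l^k + Γ^k_{ij} l^j` of the vector field with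
components `l`. -/
def covD (g : LorentzMetric n M) (e : OpenPartialHomeomorph M (Coord n))
    (l : Coord n → Fin (n + 1) → ℝ) (u : Coord n) (i k : Fin (n + 1)) : ℝ :=
  partialD i (fun v => l v k) u + ∑ j, g.christoffel e u k i j * l u j

/-- In adapted coordinates, the expansion `θ_l = k^{pq} ∇_p l_q` of the surface along `l`. -/
def expansion (g : LorentzMetric n M) (e : OpenPartialHomeomorph M (Coord n))
    (l : Coord n → Fin (n + 1) → ℝ) (u : Coord n) : ℝ :=
  ∑ p : ZIdx n, ∑ q : ZIdx n, (g.zComp e u)⁻¹ p q *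
    ∑ k, g.comp e u q.val k * g.covD e l u p.val k

/-- In adapted coordinates, `l` is a smooth vector field that is null and normal to `S` at the
points of `S`. -/
structure IsNullNormal (g : LorentzMetric n M) (S : Set M)
    (e : OpenPartialHomeomorph M (Coord n)) (l : Coord n → Fin (n + 1) → ℝ) : Prop where
  smooth : ContDiffOn ℝ ∞ l e.target
  null : ∀ u ∈ e.target, e.symm u ∈ S → g.pair e u (l u) (l u) = 0
  normal : ∀ u ∈ e.target, e.symm u ∈ S → ∀ p : ZIdx n,
    g.pair e u (l u) (Pi.single p.val 1) = 0

/-- `S` is marginally inner and outer trapped: the expansions along both of its null normals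
`l`, `m` (normalised by `g(l, m) = -1`) vanish on `S`. The null normals need exist only locally. -/
def IsMarginallyInnerOuterTrapped (g : LorentzMetric n M) (S : Set M) : Prop :=
  ∀ x ∈ S, ∃ (e : OpenPartialHomeomorph M (Coord n)) (l m : Coord n → Fin (n + 1) → ℝ),
    IsAdaptedCoord S e ∧ x ∈ e.source ∧
    g.IsNullNormal S e l ∧ g.IsNullNormal S e m ∧
    ∀ u ∈ e.target, e.symm u ∈ S →
      g.pair e u (l u) (m u) = -1 ∧ g.expansion e l u = 0 ∧ g.expansion e m u = 0

end LorentzMetric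

end

/-!
The proof is the maximum principle on `S`. For an embedded submanifold, the trace over `TS` of the
spacetime Hessian of `f` is the intrinsic Laplacian of `f|_S` minus the derivative of `f` along the
mean curvature vector. If both null expansions of a codimension-two spacelike surface vanish, its
mean curvature vector vanishes, so `f|_S` satisfies `Δ_S f = k^{pq} ∇_p ∇_q f ≥ c k^{pq} k_{pq} > 0`.
This is impossible at a maximum of `f` on the compact set `S`.

In adapted coordinates all of this is checked at the maximum point only, where `∂_p f = 0` and the
intrinsic Christoffel symbols of `S` play no role. Put `X^k = k^{pq} Γ^k_{pq}`. Differentiating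
`l_q = 0` along `S` gives `θ_l = -g(l, X)` (`LorentzMetric.expansion_eq_neg_pair`), so `X` is
orthogonal to both null normals, and a determinant argument shows that its components transverse to
`S` vanish (`eq_zero_of_transverse_dual`). Hence `X^k ∂_k f = 0` and the trace of the Hessian of `f`
over `TS` is the trace of the coordinate Hessian, which is nonpositive at a maximum
(`sum_partialD_partialD_nonpos`). The comparison of traces with a lower bound on quadratic forms is
`sum_mul_nonneg_of_posSemidef`.
-/

open scoped Matrix Topology
open Filter

/-! ### Quadratic forms and traces -/

/-- The trace of a nonnegative form with respect to a positive semidefinite (inverse) metric `K` is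
nonnegative. The matrix `Q` need not be symmetric. -/
theorem sum_mul_nonneg_of_posSemidef {ι : Type*} [Fintype ι] [DecidableEq ι]
    {K Q : Matrix ι ι ℝ} (hK : K.PosSemidef) (hQ : ∀ V : ι → ℝ, 0 ≤ quadForm Q V) :
    0 ≤ ∑ p, ∑ q, K p q * Q p q := by
  obtain ⟨m, v, rfl⟩ := Matrix.posSemidef_iff_eq_sum_vecMulVec.mp hK
  have h : ∑ p, ∑ q, (∑ i, Matrix.vecMulVec (v i) (star (v i))) p q * Q p q =
      ∑ i, quadForm Q (v i) := by
    simp only [quadForm, Matrix.sum_apply, Matrix.vecMulVec_apply, star_trivial,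
      Finset.sum_mul]
    symm
    rw [Finset.sum_comm]
    refine Finset.sum_congr rfl fun p _ => ?_
    rw [Finset.sum_comm]
    exact Finset.sum_congr rfl fun q _ => Finset.sum_congr rfl fun i _ => by ring
  rw [h]
  exact Finset.sum_nonneg fun i _ => hQ _

theorem HasLorentzSignature.isUnit_det {ι : Type*} [Fintype ι] [DecidableEq ι]
    {A : Matrix ι ι ℝ} (hA : HasLorentzSignature A) : IsUnit A.det := by
  obtain ⟨t, P, -, h⟩ := hA
  have h' := congrArg Matrix.det h
  rw [Matrix.det_mul, Matrix.det_mul, Matrix.det_diagonal] at h'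
  rw [isUnit_iff_ne_zero]
  intro h0
  rw [h0, mul_zero, zero_mul] at h'
  refine Finset.prod_ne_zero_iff.mpr (fun i _ => ?_) h'.symm
  split_ifs <;> norm_num

/-! ### Sums over coordinate indices -/

theorem sum_eq_of_eq_zero_of_two_le {n : ℕ} (hn : 2 ≤ n) {F : Fin (n + 1) → ℝ}
    (hF : ∀ i : Fin (n + 1), 2 ≤ i.val → F i = 0) :
    ∑ i, F i = F ⟨0, by omega⟩ + F ⟨1, by omega⟩ := by
  obtain ⟨m, rfl⟩ : ∃ m, n = m + 1 := ⟨n - 1, by omega⟩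
  rw [Fin.sum_univ_succ, Fin.sum_univ_succ, Finset.sum_eq_zero, add_zero]
  · rfl
  · exact fun i _ => hF _ (by simp)

/-- Let `a`, `b` be covectors annihilating the directions along the surface, with
`a(l) = 0`, `a(m) = b(l) = -1`; in the application they are the metric duals of the null normals
`l`, `m`. They span the conormal plane, so a vector `X` annihilated by both is annihilated by every
covector `w` of that plane. -/
theorem eq_zero_of_transverse_dual {n : ℕ} (hn : 2 ≤ n) {a b l m X w : Fin (n + 1) → ℝ}
    (ha : ∀ i : Fin (n + 1), 2 ≤ i.val → a i = 0) (hb : ∀ i : Fin (n + 1), 2 ≤ i.val → b i = 0)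
    (hw : ∀ i : Fin (n + 1), 2 ≤ i.val → w i = 0)
    (hal : ∑ i, a i * l i = 0) (ham : ∑ i, a i * m i = -1)
    (hbl : ∑ i, b i * l i = -1)
    (haX : ∑ i, a i * X i = 0) (hbX : ∑ i, b i * X i = 0) : ∑ i, X i * w i = 0 := by
  have key : ∀ {u v : Fin (n + 1) → ℝ}, (∀ i : Fin (n + 1), 2 ≤ i.val → u i = 0) →
      ∑ i, u i * v i = u ⟨0, by omega⟩ * v ⟨0, by omega⟩ + u ⟨1, by omega⟩ * v ⟨1, by omega⟩ :=
    fun hu => sum_eq_of_eq_zero_of_two_le hn fun i hi => by rw [hu i hi, zero_mul]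
  rw [key ha] at hal ham haX
  rw [key hb] at hbl hbX
  simp_rw [mul_comm (X _)]
  rw [key hw]
  generalize (⟨0, by omega⟩ : Fin (n + 1)) = i at *
  generalize (⟨1, by omega⟩ : Fin (n + 1)) = j at *
  -- The product of the matrix with rows `a`, `b` and the matrix with columns `l`, `m` is triangular
  -- up to a swap of rows, so its determinant is known.
  have hdet : (a i * b j - a j * b i) * (l i * m j - l j * m i) = -1 := by
    linear_combination (b i * m i + b j * m j) * hal - (b i * l i + b j * l j) * ham + hbl
  have hne : a i * b j - a j * b i ≠ 0 := by
    rintro h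
    rw [h] at hdet
    norm_num at hdet
  have hXi : X i = 0 :=
    (mul_eq_zero.mp (by linear_combination b j * haX - a j * hbX :
      (a i * b j - a j * b i) * X i = 0)).resolve_left hne
  have hXj : X j = 0 :=
    (mul_eq_zero.mp (by linear_combination a i * hbX - b i * haX :
      (a i * b j - a j * b i) * X j = 0)).resolve_left hne
  rw [hXi, hXj]
  ring

/-! ### Partial derivatives and the second derivative test -/

theorem fderiv_apply_eq_sum_partialD {n : ℕ} (φ : Coord n → ℝ) (u V : Coord n) :
    fderiv ℝ φ u V = ∑ i, V i * partialD i φ u := by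
  conv_lhs => rw [← (EuclideanSpace.basisFun (Fin (n + 1)) ℝ).sum_repr V]
  simp [partialD, map_sum]

theorem hasDerivAt_comp_line {n : ℕ} {φ : Coord n → ℝ} {u V : Coord n} {t : ℝ}
    (hφ : DifferentiableAt ℝ φ (u + t • V)) :
    HasDerivAt (fun s : ℝ => φ (u + s • V)) (∑ i, V i * partialD i φ (u + t • V)) t := by
  rw [← fderiv_apply_eq_sum_partialD]
  have h : HasDerivAt (fun s : ℝ => u + s • V) V t := by
    simpa using ((hasDerivAt_id t).smul_const V).const_add u
  exact hφ.hasFDerivAt.comp_hasDerivAt t h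

theorem contDiffOn_partialD {n : ℕ} {φ : Coord n → ℝ} {U : Set (Coord n)} (hU : IsOpen U)
    (hφ : ContDiffOn ℝ ∞ φ U) (i : Fin (n + 1)) : ContDiffOn ℝ ∞ (partialD i φ) U :=
  (hφ.fderiv_of_isOpen hU (by simp)).clm_apply contDiffOn_const

theorem eventually_line_mem {n : ℕ} {U : Set (Coord n)} (hU : IsOpen U) {u : Coord n}
    (hu : u ∈ U) (V : Coord n) : ∀ᶠ t : ℝ in 𝓝 0, u + t • V ∈ U := by
  have h : Continuous fun t : ℝ => u + t • V := by fun_prop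
  exact h.continuousAt.eventually_mem (hU.mem_nhds (by simpa using hu))

theorem deriv_deriv_nonpos_of_isLocalMax {h : ℝ → ℝ} {x : ℝ} (hmax : IsLocalMax h x)
    (hc : ContinuousAt h x) : deriv (deriv h) x ≤ 0 := by
  by_contra! hpos
  -- Otherwise `x` is also a local minimum, so `h` is constant near `x`.
  have hmin := isLocalMin_of_deriv_deriv_pos hpos hmax.deriv_eq_zero hc
  have hconst : h =ᶠ[𝓝 x] fun _ => h x := by
    filter_upwards [hmax, hmin] with y h1 h2 using le_antisymm h1 h2
  have h2 := hconst.deriv.deriv_eq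
  simp only [deriv_const'] at h2
  simp [h2] at hpos

/-- The first order condition at a maximum along a line. -/
theorem sum_partialD_eq_zero {n : ℕ} {φ : Coord n → ℝ} {U : Set (Coord n)} (hU : IsOpen U)
    (hφ : ContDiffOn ℝ ∞ φ U) {u : Coord n} (hu : u ∈ U) {V : Coord n}
    (hmax : IsLocalMax (fun t : ℝ => φ (u + t • V)) 0) : ∑ i, V i * partialD i φ u = 0 := by
  have hd : DifferentiableAt ℝ φ (u + (0 : ℝ) • V) := by
    simpa using (hφ.differentiableOn (by simp)).differentiableAt (hU.mem_nhds hu)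
  simpa using hmax.hasDerivAt_eq_zero (hasDerivAt_comp_line hd)

/-- The second order condition at a maximum along a line. -/
theorem sum_partialD_partialD_nonpos {n : ℕ} {φ : Coord n → ℝ} {U : Set (Coord n)}
    (hU : IsOpen U) (hφ : ContDiffOn ℝ ∞ φ U) {u : Coord n} (hu : u ∈ U) {V : Coord n}
    (hmax : IsLocalMax (fun t : ℝ => φ (u + t • V)) 0) :
    ∑ i, ∑ j, partialD i (partialD j φ) u * V i * V j ≤ 0 := by
  have hd : ∀ {ψ : Coord n → ℝ}, ContDiffOn ℝ ∞ ψ U → ∀ {v}, v ∈ U → DifferentiableAt ℝ ψ v :=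
    fun hψ _ hv => (hψ.differentiableOn (by simp)).differentiableAt (hU.mem_nhds hv)
  have hu0 : u + (0 : ℝ) • V ∈ U := by simpa using hu
  have h1 : deriv (fun t : ℝ => φ (u + t • V))
      =ᶠ[𝓝 0] fun t => ∑ j, V j * partialD j φ (u + t • V) := by
    filter_upwards [eventually_line_mem hU hu V] with t ht
    exact (hasDerivAt_comp_line (hd hφ ht)).deriv
  have h2 : HasDerivAt (fun t : ℝ => ∑ j, V j * partialD j φ (u + t • V))
      (∑ j, V j * ∑ i, V i * partialD i (partialD j φ) (u + (0 : ℝ) • V)) 0 :=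
    HasDerivAt.fun_sum fun j _ =>
      (hasDerivAt_comp_line (hd (contDiffOn_partialD hU hφ j) hu0)).const_mul (V j)
  have h3 := deriv_deriv_nonpos_of_isLocalMax hmax
    (hasDerivAt_comp_line (hd hφ hu0)).continuousAt
  rw [h1.deriv_eq, h2.deriv, zero_smul, add_zero] at h3
  rw [Finset.sum_comm]
  refine le_of_eq_of_le (Finset.sum_congr rfl fun j _ => ?_) h3
  rw [Finset.mul_sum]
  exact Finset.sum_congr rfl fun i _ => by ring

namespace LorentzMetric

variable {n : ℕ} {M : Type*} [TopologicalSpace M] [ChartedSpace (Coord n) M]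

/-! ### Expansions and the mean curvature vector -/

theorem comp_symm (g : LorentzMetric n M) (e : OpenPartialHomeomorph M (Coord n)) (u : Coord n)
    (i j : Fin (n + 1)) : g.comp e u i j = g.comp e u j i :=
  g.symm _ _ _

/-- The Christoffel symbols of the first kind. -/
theorem sum_comp_mul_christoffel (g : LorentzMetric n M) {e : OpenPartialHomeomorph M (Coord n)}
    (he : IsCoordSystem n M e) {u : Coord n} (hu : u ∈ e.target) (q i j : Fin (n + 1)) :
    ∑ k, g.comp e u q k * g.christoffel e u k i j =
      (1 / 2 : ℝ) * (partialD i (fun v => g.comp e v j q) u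
        + partialD j (fun v => g.comp e v i q) u - partialD q (fun v => g.comp e v i j) u) := by
  have hinv : g.comp e u * (g.comp e u)⁻¹ = 1 :=
    Matrix.mul_nonsing_inv _ (g.lorentz e he u hu).isUnit_det
  set D : Fin (n + 1) → ℝ := fun l => partialD i (fun v => g.comp e v j l) u
    + partialD j (fun v => g.comp e v i l) u - partialD l (fun v => g.comp e v i j) u with hD
  have h : g.comp e u *ᵥ ((g.comp e u)⁻¹ *ᵥ D) = D := by
    rw [Matrix.mulVec_mulVec, hinv, Matrix.one_mulVec]
  have hq := congrFun h q
  simp only [Matrix.mulVec, dotProduct] at hq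
  change _ = (1 / 2 : ℝ) * D q
  rw [← hq, Finset.mul_sum]
  refine Finset.sum_congr rfl fun k _ => ?_
  simp only [christoffel, hD]
  ring

/-- The vector `X^k = k^{pq} Γ^k_{pq}`. At a point of `S` its normal part is the mean curvature
vector `k^{pq} (∇_p ∂_q)^⊥` of `S`. -/
noncomputable def zTraceChristoffel (g : LorentzMetric n M) (e : OpenPartialHomeomorph M (Coord n))
    (u : Coord n) (k : Fin (n + 1)) : ℝ :=
  ∑ p : ZIdx n, ∑ q : ZIdx n, (g.zComp e u)⁻¹ p q * g.christoffel e u k p.val q.val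

theorem pair_single (g : LorentzMetric n M) (e : OpenPartialHomeomorph M (Coord n))
    (u : Coord n) (V : Fin (n + 1) → ℝ) (p : Fin (n + 1)) :
    g.pair e u V (Pi.single p 1) = ∑ i, g.comp e u i p * V i := by
  simp [pair, Pi.single_apply]

theorem pair_eq_sum (g : LorentzMetric n M) (e : OpenPartialHomeomorph M (Coord n))
    (u : Coord n) (V W : Fin (n + 1) → ℝ) :
    g.pair e u V W = ∑ j, (∑ i, g.comp e u i j * V i) * W j := by
  rw [pair, Finset.sum_comm]
  simp_rw [Finset.sum_mul]

/-- Coordinate lines in the directions `z^p` stay in `S`. -/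
theorem _root_.IsAdaptedCoord.eventually_line {S : Set M}
    {e : OpenPartialHomeomorph M (Coord n)} (he : IsAdaptedCoord S e) {u : Coord n}
    (hu : u ∈ e.target) (huS : e.symm u ∈ S) {V : Coord n}
    (hV : ∀ a : YIdx n, V a.val = 0) :
    ∀ᶠ t : ℝ in 𝓝 0, u + t • V ∈ e.target ∧ e.symm (u + t • V) ∈ S := by
  obtain ⟨-, y₀, hy⟩ := he
  filter_upwards [eventually_line_mem e.open_target hu V] with t ht
  refine ⟨ht, (hy _ ht).mpr fun a => ?_⟩
  simpa [hV a] using (hy u hu).mp huS a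

/-- Differentiating the normality `g_{qk} l^k = 0` along `S`. -/
theorem IsNullNormal.sum_comp_mul_partialD {g : LorentzMetric n M} {S : Set M}
    {e : OpenPartialHomeomorph M (Coord n)} {l : Coord n → Fin (n + 1) → ℝ}
    (hl : g.IsNullNormal S e l) (he : IsAdaptedCoord S e) {u : Coord n} (hu : u ∈ e.target)
    (huS : e.symm u ∈ S) (p q : ZIdx n) :
    ∑ k, g.comp e u k q.val * partialD p.val (fun v => l v k) u =
      -∑ k, partialD p.val (fun v => g.comp e v k q.val) u * l u k := by
  have hnhds := e.open_target.mem_nhds hu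
  have hdg : ∀ k, DifferentiableAt ℝ (fun v => g.comp e v k q.val) u := fun k =>
    ((g.smooth e he.1 k q.val).differentiableOn (by simp)).differentiableAt hnhds
  have hdl : ∀ k, DifferentiableAt ℝ (fun v => l v k) u := fun k =>
    differentiableAt_pi.mp ((hl.smooth.differentiableOn (by simp)).differentiableAt hnhds) k
  set ψ : Coord n → ℝ := fun v => ∑ k, g.comp e v k q.val * l v k with hψ
  have hψd : HasFDerivAt ψ _ u :=
    HasFDerivAt.fun_sum fun k _ => (hdg k).hasFDerivAt.mul (hdl k).hasFDerivAt
  -- The function `ψ = l_q` vanishes on `S`, hence so does its derivative along `S`.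
  have hzero : partialD p.val ψ u = 0 := by
    set V : Coord n := EuclideanSpace.single p.val 1 with hVdef
    have hV : ∀ a : YIdx n, V a.val = 0 := fun a => by
      have : a.val ≠ p.val := fun h => by have := a.2; have := p.2; rw [h] at *; omega
      simp [hVdef, this]
    have hd : DifferentiableAt ℝ ψ (u + (0 : ℝ) • V) := by simpa using hψd.differentiableAt
    have h := hasDerivAt_comp_line hd
    have h0 : (fun t : ℝ => ψ (u + t • V)) =ᶠ[𝓝 0] fun _ => 0 := by
      filter_upwards [he.eventually_line hu huS hV] with t ht
      have := hl.normal _ ht.1 ht.2 q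
      rwa [pair_single] at this
    have h' := h.deriv
    rw [h0.deriv_eq, deriv_const, zero_smul, add_zero, ← fderiv_apply_eq_sum_partialD] at h'
    exact h'.symm
  rw [partialD, hψd.fderiv] at hzero
  simp only [sum_apply, add_apply, smul_apply, smul_eq_mul, Finset.sum_add_distrib] at hzero
  simp only [partialD]
  rw [eq_neg_iff_add_eq_zero, ← hzero]
  congr 1
  exact Finset.sum_congr rfl fun k _ => mul_comm _ _

/-- The expansion along a null normal `l` is minus the inner product of `l` with
`k^{pq} Γ^k_{pq}`, hence with the mean curvature vector. -/
theorem expansion_eq_neg_pair {g : LorentzMetric n M} {S : Set M}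
    {e : OpenPartialHomeomorph M (Coord n)} {l : Coord n → Fin (n + 1) → ℝ}
    (hl : g.IsNullNormal S e l) (he : IsAdaptedCoord S e) {u : Coord n} (hu : u ∈ e.target)
    (huS : e.symm u ∈ S) :
    g.expansion e l u = -g.pair e u (l u) (g.zTraceChristoffel e u) := by
  have hterm : ∀ p q : ZIdx n, ∑ k, g.comp e u q.val k * g.covD e l u p.val k =
      -∑ j, l u j * ∑ k, g.comp e u j k * g.christoffel e u k p.val q.val := by
    intro p q
    have h1 : ∑ k, g.comp e u q.val k * g.covD e l u p.val k =
        ∑ k, g.comp e u k q.val * partialD p.val (fun v => l v k) u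
          + ∑ j, l u j * ∑ k, g.comp e u q.val k * g.christoffel e u k p.val j := by
      simp only [covD, mul_add, Finset.sum_add_distrib, Finset.mul_sum]
      congr 1
      · exact Finset.sum_congr rfl fun k _ => by rw [comp_symm]
      · rw [Finset.sum_comm]
        exact Finset.sum_congr rfl fun j _ => Finset.sum_congr rfl fun k _ => by ring
    rw [h1, hl.sum_comp_mul_partialD he hu huS, ← Finset.sum_neg_distrib,
      ← Finset.sum_neg_distrib, ← Finset.sum_add_distrib]
    refine Finset.sum_congr rfl fun j _ => ?_
    rw [g.sum_comp_mul_christoffel he.1 hu, g.sum_comp_mul_christoffel he.1 hu]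
    have hs : ∀ i k, (fun v => g.comp e v i k) = fun v => g.comp e v k i :=
      fun i k => funext fun v => g.comp_symm e v i k
    rw [hs q.val j]
    ring
  have hX : ∀ j, ∑ k, g.comp e u j k * g.zTraceChristoffel e u k =
      ∑ p : ZIdx n, ∑ q : ZIdx n, (g.zComp e u)⁻¹ p q *
        ∑ k, g.comp e u j k * g.christoffel e u k p.val q.val := by
    intro j
    simp only [zTraceChristoffel, Finset.mul_sum]
    rw [Finset.sum_comm]
    refine Finset.sum_congr rfl fun p _ => ?_
    rw [Finset.sum_comm]
    exact Finset.sum_congr rfl fun q _ => Finset.sum_congr rfl fun k _ => by ring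
  have hpair : g.pair e u (l u) (g.zTraceChristoffel e u) =
      ∑ j, l u j * ∑ k, g.comp e u j k * g.zTraceChristoffel e u k := by
    simp only [pair, Finset.mul_sum]
    exact Finset.sum_congr rfl fun j _ => Finset.sum_congr rfl fun k _ => by ring
  rw [hpair, expansion]
  simp only [hX, hterm, mul_neg, Finset.sum_neg_distrib, neg_inj]
  have hswap : ∀ T : Fin (n + 1) → ZIdx n → ZIdx n → ℝ,
      ∑ p, ∑ q, (g.zComp e u)⁻¹ p q * ∑ j, l u j * T j p q =
        ∑ j, l u j * ∑ p, ∑ q, (g.zComp e u)⁻¹ p q * T j p q := by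
    intro T
    simp only [Finset.mul_sum]
    symm
    rw [Finset.sum_comm]
    refine Finset.sum_congr rfl fun p _ => ?_
    rw [Finset.sum_comm]
    exact Finset.sum_congr rfl fun q _ => Finset.sum_congr rfl fun j _ => by ring
  exact hswap _

/-- Where both expansions vanish, the vector `k^{pq} Γ^k_{pq}` is tangent to `S`, so it is
annihilated by every covector `w` that vanishes on `TS`. -/
theorem sum_zTraceChristoffel_mul_eq_zero (hn : 2 ≤ n) {g : LorentzMetric n M} {S : Set M}
    {e : OpenPartialHomeomorph M (Coord n)} {l m : Coord n → Fin (n + 1) → ℝ}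
    (hl : g.IsNullNormal S e l) (hm : g.IsNullNormal S e m) (he : IsAdaptedCoord S e)
    {u : Coord n} (hu : u ∈ e.target) (huS : e.symm u ∈ S)
    (hlm : g.pair e u (l u) (m u) = -1) (hθl : g.expansion e l u = 0)
    (hθm : g.expansion e m u = 0) {w : Fin (n + 1) → ℝ}
    (hw : ∀ i : Fin (n + 1), 2 ≤ i.val → w i = 0) :
    ∑ k, g.zTraceChristoffel e u k * w k = 0 := by
  have hml : g.pair e u (m u) (l u) = -1 := by
    rw [← hlm, pair, Finset.sum_comm]
    exact Finset.sum_congr rfl fun i _ => Finset.sum_congr rfl fun j _ => by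
      rw [comp_symm]; ring
  rw [expansion_eq_neg_pair hl he hu huS, neg_eq_zero] at hθl
  rw [expansion_eq_neg_pair hm he hu huS, neg_eq_zero] at hθm
  have hll := hl.null u hu huS
  rw [pair_eq_sum] at hlm hml hll hθl hθm
  refine eq_zero_of_transverse_dual hn (a := fun j => ∑ i, g.comp e u i j * l u i)
    (b := fun j => ∑ i, g.comp e u i j * m u i) (fun i hi => ?_) (fun i hi => ?_) hw
    hll hlm hml hθl hθm
  · simpa [pair_single] using hl.normal u hu huS ⟨i, hi⟩
  · simpa [pair_single] using hm.normal u hu huS ⟨i, hi⟩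

/-! ### The maximum principle on the surface -/

/-- Extending a vector along the surface by zero restricts a quadratic form to its block of indices
`p ≥ 2`. -/
theorem quadForm_extend_eq (A : Matrix (Fin (n + 1)) (Fin (n + 1)) ℝ) (W : ZIdx n → ℝ) :
    quadForm A (fun i => if h : 2 ≤ i.val then W ⟨i, h⟩ else 0) =
      quadForm (A.submatrix Subtype.val Subtype.val) W := by
  have key : ∀ F : Fin (n + 1) → ℝ, (∀ i : Fin (n + 1), ¬ 2 ≤ i.val → F i = 0) →
      ∑ i, F i = ∑ p : ZIdx n, F p.val := by
    intro F hF
    rw [← Finset.sum_filter_add_sum_filter_not Finset.univ (fun i : Fin (n + 1) => 2 ≤ i.val),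
      Finset.sum_eq_zero (s := Finset.univ.filter fun i : Fin (n + 1) => ¬ 2 ≤ i.val)
        fun i hi => hF i (Finset.mem_filter.mp hi).2, add_zero]
    exact (Finset.sum_subtype _ (by simp) F)
  rw [quadForm, key _ fun i hi => by simp [hi]]
  refine Finset.sum_congr rfl fun p _ => ?_
  rw [key _ fun i hi => by simp [hi]]
  refine Finset.sum_congr rfl fun q _ => ?_
  simp [p.2, q.2]

end LorentzMetric

theorem mainTheorem1 (n : ℕ) (hn : 2 ≤ n)
    {M : Type*} [TopologicalSpace M] [ChartedSpace (Coord n) M]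
    [IsManifold 𝓘(ℝ, Coord n) ∞ M]
    (g : LorentzMetric n M) (f : M → ℝ) (hf : g.IsSpacetimeConvex f)
    (S : Set M) (hS : g.IsClosedSpacelikeSurface S) (hsplit : g.SplitsNear S) :
    ¬ g.IsMarginallyInnerOuterTrapped S := by
  intro htrap
  obtain ⟨hsm, -, c, hc, hconv⟩ := hf
  obtain ⟨x, hxS, hxmax⟩ := hS.compact.exists_isMaxOn hS.nonempty hsm.continuous.continuousOn
  obtain ⟨e, l, m, he, hxe, hl, hm, hθ⟩ := htrap x hxS
  set u : Coord n := e x with hu_def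
  have hu : u ∈ e.target := e.map_source hxe
  have hux : e.symm u = x := e.left_inv hxe
  have huS : e.symm u ∈ S := hux ▸ hxS
  obtain ⟨hlm, hθl, hθm⟩ := hθ u hu huS
  set φ : Coord n → ℝ := fun w => f (e.symm w) with hφ_def
  have hφ : ContDiffOn ℝ ∞ φ e.target := contMDiffOn_iff_contDiffOn.mp
    (hsm.comp_contMDiffOn (contMDiffOn_symm_of_mem_maximalAtlas he.1))
  have hmax : ∀ V : Coord n, (∀ a : YIdx n, V a.val = 0) →
      IsLocalMax (fun t : ℝ => φ (u + t • V)) 0 := by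
    intro V hV
    filter_upwards [he.eventually_line hu huS hV] with t ht
    simpa [hφ_def, hux] using hxmax ht.2
  have hgrad : ∀ i : Fin (n + 1), 2 ≤ i.val → partialD i φ u = 0 := by
    intro i hi
    have h := sum_partialD_eq_zero e.open_target hφ hu
      (hmax (EuclideanSpace.single i 1) fun a => by
        have : a.val ≠ i := fun h => by have := a.2; rw [h] at this; omega
        simp [this])
    simpa [Pi.single_apply] using h
  have hX := LorentzMetric.sum_zTraceChristoffel_mul_eq_zero hn hl hm he hu huS hlm hθl hθm hgrad
  have hk := hS.spacelike e he u hu huS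
  set K := g.zComp e u with hK
  set A : Matrix (ZIdx n) (ZIdx n) ℝ :=
    Matrix.of fun p q => partialD p.val (partialD q.val φ) u with hA
  set H : Matrix (ZIdx n) (ZIdx n) ℝ := (g.hess f e u).submatrix Subtype.val Subtype.val with hH
  have hA_nonpos : ∀ W, quadForm A W ≤ 0 := by
    intro W
    have h := sum_partialD_partialD_nonpos e.open_target hφ hu
      (hmax (WithLp.toLp 2 fun i => if h : 2 ≤ i.val then W ⟨i, h⟩ else 0) fun a => by
        simp [a.2])
    have h' := LorentzMetric.quadForm_extend_eq
      (Matrix.of fun i j => partialD i (partialD j φ) u) W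
    exact h'.symm.trans_le h
  have hH_ge : ∀ W, c * quadForm K W ≤ quadForm H W := by
    intro W
    have h := hconv e he.1 u hu fun i => if h : 2 ≤ i.val then W ⟨i, h⟩ else 0
    rwa [LorentzMetric.quadForm_extend_eq, LorentzMetric.quadForm_extend_eq] at h
  have hnonneg := sum_mul_nonneg_of_posSemidef (Q := H - c • K - A) hk.inv.posSemidef fun W => by
    have : quadForm (H - c • K - A) W = quadForm H W - c * quadForm K W - quadForm A W := by
      simp only [quadForm, Matrix.sub_apply, Matrix.smul_apply, smul_eq_mul, sub_mul,
        Finset.sum_sub_distrib, Finset.mul_sum, mul_assoc]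
    linarith [hH_ge W, hA_nonpos W]
  -- The traces of `H` and `A` agree because the mean curvature vector vanishes.
  have htrHA : ∑ p, ∑ q, K⁻¹ p q * (H - A) p q = 0 := by
    have h : ∑ p, ∑ q, K⁻¹ p q * (H - A) p q =
        -∑ k, g.zTraceChristoffel e u k * partialD k φ u := by
      have hHA : ∀ p q, (H - A) p q =
          -∑ k, g.christoffel e u k p.val q.val * partialD k φ u := by
        intro p q
        simp only [hH, hA, hφ_def, Matrix.sub_apply, Matrix.submatrix_apply, LorentzMetric.hess,
          Matrix.of_apply]
        ring
      simp only [hHA, LorentzMetric.zTraceChristoffel, Finset.sum_mul, Finset.mul_sum, mul_neg,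
        Finset.sum_neg_distrib, neg_inj]
      symm
      rw [Finset.sum_comm]
      refine Finset.sum_congr rfl fun p _ => ?_
      rw [Finset.sum_comm]
      exact Finset.sum_congr rfl fun q _ => Finset.sum_congr rfl fun k _ => by rw [mul_assoc]
    rw [h, hX, neg_zero]
  have htrK : ∑ p, ∑ q, K⁻¹ p q * K p q = Fintype.card (ZIdx n) := by
    rw [← Matrix.trace_one (R := ℝ),
      ← Matrix.nonsing_inv_mul K ((Matrix.isUnit_iff_isUnit_det K).mp hk.isUnit)]
    simp only [Matrix.trace, Matrix.diag_apply, Matrix.mul_apply]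
    exact Finset.sum_congr rfl fun p _ => Finset.sum_congr rfl fun q _ => by
      rw [hK, LorentzMetric.zComp, Matrix.submatrix_apply, Matrix.submatrix_apply, g.comp_symm]
  have hcard : (0 : ℝ) < Fintype.card (ZIdx n) := by
    have : Nonempty (ZIdx n) := ⟨⟨⟨2, by omega⟩, le_rfl⟩⟩
    exact_mod_cast Fintype.card_pos
  have hsplitsum : ∑ p, ∑ q, K⁻¹ p q * (H - c • K - A) p q =
      ∑ p, ∑ q, K⁻¹ p q * (H - A) p q - c * ∑ p, ∑ q, K⁻¹ p q * K p q := by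
    simp only [Finset.mul_sum, ← Finset.sum_sub_distrib]
    refine Finset.sum_congr rfl fun p _ => Finset.sum_congr rfl fun q _ => ?_
    simp only [Matrix.sub_apply, Matrix.smul_apply, smul_eq_mul]
    ring
  rw [hsplitsum, htrHA, htrK] at hnonneg
  nlinarith [mul_pos hc hcard]
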